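/- Let $d\ge 1$. Let $\mathbb{E}^d$ be the set of pairs $\{x,y\}\subset\mathbb{Z}^d$ with Euclidean distance $\|x-y\|=1$. For $p\in[0,1]$, let $\mathbb{P}_p$ denote Bernoulli percolation on $\mathbb{Z}^d$: the random graph $\omega$ with vertex set $\mathbb{Z}^d$ in which each edge of $\mathbb{E}^d$ is kept with probability $p$ and erased with probability $1-p$, independently of the others. Let $p_c=p_c(d)\in[0,1]$ be the critical point, that is, the supremum of the $p\in[0,1]$ for which $\omega$ has $\mathbb{P}_p$-almost surely no infinite connected component. Put $\Lambda_n=[-n,n]^d\cap\mathbb{Z}^d$ and $\partial\Lambda_n=\Lambda_n\setminus\Lambda_{n-1}$; write $0\leftrightarrow\partial\Lambda_n$ for the event that $\omega$ contains a path from $0$ to a vertex of $\partial\Lambda_n$, and $0\leftrightarrow\infty$ for the event that $0$ is in an infinite connected component of $\omega$. Then: 1. For every $p\in[0,1]$ with $p<p_c$ there exists $c_p>0$ such that for all integers $n\ge 1$, $\mathbb{P}_p[0\leftrightarrow\partial\Lambda_n]\le \exp(-c_p n)$. 2. There exists $c>0$ (depending only on $d$) such that for every $p\in[0,1]$ with $p>p_c$,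 $\mathbb{P}_p[0\leftrightarrow\infty]\ge c\,(p-p_c)$. -/

import Mathlib

open MeasureTheory ProbabilityTheory
open scoped unitInterval

namespace Percolation

/-- The lattice `ℤ^d` as a graph: `x` and `y` are joined by an edge when their Euclidean distance,
here squared to stay in the integers, equals `1`. -/
def lattice (d : ℕ) : SimpleGraph (Fin d → ℤ) where
  Adj x y := ∑ i, (x i - y i) ^ 2 = 1
  symm := ⟨fun x y h => by
    rw [← h]
    exact Finset.sum_congr rfl fun i _ => by ring⟩
  loopless := ⟨fun x h => by simp at h⟩

/-- Adjacency says exactly that the Euclidean norm of `x - y` is `1`. -/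
theorem lattice_adj_iff_norm {d : ℕ} (x y : Fin d → ℤ) :
    (lattice d).Adj x y ↔
      ‖(WithLp.toLp 2 (fun i => (x i : ℝ) - (y i : ℝ)) : EuclideanSpace ℝ (Fin d))‖ = 1 := by
  rw [EuclideanSpace.norm_eq, Real.sqrt_eq_one]
  simp only [lattice, Real.norm_eq_abs, sq_abs]
  exact_mod_cast Iff.rfl

/-- The edge set `𝔼^d` of the lattice. -/
abbrev Edge (d : ℕ) : Type := (lattice d).edgeSet

/-- A percolation configuration; the edge `e` is open (kept) when `ω e = true`. -/
abbrev Config (d : ℕ) : Type := Edge d → Bool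

/-- Bernoulli percolation `P_p`: the product, over all edges, of the Bernoulli law that gives
mass `p` to `true` and `1 - p` to `false`. -/
noncomputable def bernoulliPerc (d : ℕ) (p : I) : Measure (Config d) :=
  Measure.infinitePi fun _ : Edge d => bernoulliMeasure true false p

/-- The random graph on `ℤ^d` made of the open edges of `ω`. -/
def openGraph {d : ℕ} (ω : Config d) : SimpleGraph (Fin d → ℤ) :=
  SimpleGraph.fromEdgeSet {e | ∃ h : e ∈ (lattice d).edgeSet, ω ⟨e, h⟩ = true}

/-- The box `Λ_n = [-n, n]^d`, for an integer `n`. -/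
def box (d : ℕ) (n : ℤ) : Set (Fin d → ℤ) := {x | ∀ i, -n ≤ x i ∧ x i ≤ n}

/-- `∂Λ_n = Λ_n \ Λ_{n-1}`. -/
def boxBoundary (d : ℕ) (n : ℤ) : Set (Fin d → ℤ) := box d n \ box d (n - 1)

/-- The event `0 ↔ ∂Λ_n`. -/
def connBoundary (d : ℕ) (n : ℤ) : Set (Config d) :=
  {ω | ∃ y ∈ boxBoundary d n, (openGraph ω).Reachable 0 y}

/-- The event `0 ↔ ∞`: the origin lies in an infinite connected component. -/
def connInfinity (d : ℕ) : Set (Config d) :=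
  {ω | ((openGraph ω).connectedComponentMk 0).supp.Infinite}

/-- The event that there is an infinite connected component. -/
def existsInfinite (d : ℕ) : Set (Config d) :=
  {ω | ∃ C : (openGraph ω).ConnectedComponent, C.supp.Infinite}

/-- The critical point `p_c`: the supremum of the `p ∈ [0, 1]` for which there is almost surely
no infinite connected component. -/
noncomputable def criticalPoint (d : ℕ) : ℝ :=
  sSup {p : ℝ | ∃ h : p ∈ I, bernoulliPerc d ⟨p, h⟩ (existsInfinite d) = 0}

end Percolation

/-! This is the Duminil-Copin–Tassion argument. For a finite `S` containing `0`, let φ_p(S) =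
`expectedBoundary p S`; everything depends on whether some φ_p(S) is below 1.

If φ_p(S) < 1, split a path leaving a large cube at its last edge out of the cluster of `0` in `S`.
Independence gives θ_{n+L} ≤ φ_p(S) θ_n for the exit probabilities θ_n (`measureReal_exits_le`,
`exists_exitProb_add_le`), hence exponential decay when p < 1, and no infinite cluster.

If φ_p(S) ≥ 1 for all such `S`, condition on the set of vertices that cannot leave the cube. Every
edge counted by its boundary is pivotal, so Russo's formula gives θ_n' ≥ 1 - θ_n
(`one_sub_le_sum_pivotal`). Integrating over an interval of parameters bounds the probability of an
infinite cluster at the origin below by half its length (`half_sub_le_connInfinity`).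

Since φ_p(S) increases with p, the second alternative cannot occur below p_c; the first cannot occur
strictly between p_c and 1. These two facts give the two claims. -/

namespace Percolation

/-! ### Russo's inequality on a finite cube of configurations -/

section Russo

variable {ι : Type*} [Fintype ι] [DecidableEq ι]

/-- The Bernoulli weight of a finite configuration. -/
def bernoulliWeight (x : ℝ) (T : ι → Bool) : ℝ := ∏ i, if T i then x else 1 - x

open Classical in
/-- The probability of a set of finite configurations, as a polynomial in the parameter. -/
noncomputable def bernoulliSum (A : Set (ι → Bool)) (x : ℝ) : ℝ :=
  ∑ T : ι → Bool, if T ∈ A then bernoulliWeight x T else 0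

/-- The contribution of the coordinate `i` to the derivative of `bernoulliWeight`. -/
def weightSlope (x : ℝ) (i : ι) (T : ι → Bool) : ℝ :=
  (∏ j ∈ Finset.univ.erase i, if T j then x else 1 - x) * if T i then 1 else -1

theorem hasDerivAt_bernoulliWeight (x : ℝ) (T : ι → Bool) :
    HasDerivAt (fun x => bernoulliWeight x T) (∑ i, weightSlope x i T) x := by
  have h : ∀ i ∈ Finset.univ, HasDerivAt (fun x : ℝ => if T i then x else 1 - x)
      (if T i then 1 else -1) x := by
    intro i _
    split_ifs
    · exact hasDerivAt_id x
    · simpa using (hasDerivAt_id x).const_sub 1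
  simpa [weightSlope, bernoulliWeight] using HasDerivAt.fun_finsetProd h

open Classical in
theorem hasDerivAt_bernoulliSum (A : Set (ι → Bool)) (x : ℝ) :
    HasDerivAt (bernoulliSum A) (∑ i, ∑ T, if T ∈ A then weightSlope x i T else 0) x := by
  rw [Finset.sum_comm]
  unfold bernoulliSum
  refine HasDerivAt.fun_sum fun T _ => ?_
  split_ifs
  · exact hasDerivAt_bernoulliWeight x T
  · simpa using hasDerivAt_const x (0 : ℝ)

/-- The configurations outside `A` that enter `A` once the coordinate `i` is opened. -/
def pivotalSet (A : Set (ι → Bool)) (i : ι) : Set (ι → Bool) :=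
  {T | T ∉ A ∧ Function.update T i true ∈ A}

theorem update_not_involutive {ι : Type*} [DecidableEq ι] (i : ι) :
    Function.Involutive fun T : ι → Bool => Function.update T i (!T i) := by
  intro T
  simp

open Classical in
-- Pair each configuration with its flip at `i`. The two slopes are `r` and `-r`, where `r` is the
-- weight of the other coordinates, so a pair contributes `r` if `i` is pivotal and `0` otherwise.
-- The left side only counts the closed member, of weight `(1 - x) * r ≤ r`.
theorem bernoulliSum_pivotalSet_le {A : Set (ι → Bool)} (hA : IsUpperSet A) {x : ℝ}
    (hx0 : 0 ≤ x) (hx1 : x ≤ 1) (i : ι) :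
    bernoulliSum (pivotalSet A i) x ≤ ∑ T, if T ∈ A then weightSlope x i T else 0 := by
  set L : (ι → Bool) → ℝ := fun T => if T ∈ A then weightSlope x i T else 0 with hL
  set R : (ι → Bool) → ℝ := fun T => if T ∈ pivotalSet A i then bernoulliWeight x T else 0 with hR
  set flip := (update_not_involutive i).toPerm
  have hflipT : ∀ T, flip T = Function.update T i (!T i) := fun T => rfl
  have key : ∀ T : ι → Bool, T i = false → R T + R (flip T) ≤ L T + L (flip T) := by
    intro T hT
    have hs : flip T = Function.update T i true := by rw [hflipT, hT]; rfl
    have hle : T ≤ Function.update T i true := by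
      rw [le_update_iff]; exact ⟨Bool.le_true _, fun _ _ => le_rfl⟩
    set r := ∏ j ∈ Finset.univ.erase i, (if T j then x else 1 - x) with hr
    have hr0 : 0 ≤ r := Finset.prod_nonneg fun j _ => by split_ifs <;> linarith
    have hr' : ∏ j ∈ Finset.univ.erase i, (if Function.update T i true j then x else 1 - x) = r :=
      Finset.prod_congr rfl fun j hj => by rw [Function.update_of_ne (Finset.ne_of_mem_erase hj)]
    have hw : bernoulliWeight x T = (1 - x) * r := by
      rw [bernoulliWeight, ← Finset.mul_prod_erase _ _ (Finset.mem_univ i)]; simp [hT, hr]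
    have h1 : weightSlope x i T = -r := by simp [weightSlope, hT, ← hr]
    have h2 : weightSlope x i (Function.update T i true) = r := by
      rw [weightSlope, hr']; simp
    have h3 : R (flip T) = 0 := by
      rw [hs]; simp [hR, pivotalSet]
    rw [h3, hs]
    simp only [hL, hR, pivotalSet, Set.mem_ofPred_eq, h1, h2, hw]
    by_cases hTA : T ∈ A
    · have := hA hle hTA
      simp [hTA, this]
    · by_cases hTA' : Function.update T i true ∈ A
      · simp only [hTA, hTA', not_false_eq_true, and_self, if_true, if_false]
        nlinarith
      · simp [hTA, hTA']
  have key' : ∀ T, R T + R (flip T) ≤ L T + L (flip T) := by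
    intro T
    cases hT : T i
    · exact key T hT
    · have h := key (flip T) (by simp [hflipT, hT])
      have hflip2 : flip (flip T) = T := update_not_involutive i T
      rw [hflip2] at h
      linarith
  -- The flip is a bijection, so summing over all `T` counts both sides twice.
  have hsum := Finset.sum_le_sum fun T (_ : T ∈ Finset.univ) => key' T
  rw [Finset.sum_add_distrib, Finset.sum_add_distrib, Equiv.sum_comp flip R, Equiv.sum_comp flip L] at hsum
  change ∑ T, R T ≤ ∑ T, L T
  linarith

/-- A lower bound in Russo's formula. -/
theorem exists_hasDerivAt_bernoulliSum {A : Set (ι → Bool)} (hA : IsUpperSet A) {x : ℝ}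
    (hx0 : 0 ≤ x) (hx1 : x ≤ 1) :
    ∃ D, HasDerivAt (bernoulliSum A) D x ∧ ∑ i, bernoulliSum (pivotalSet A i) x ≤ D :=
  ⟨_, hasDerivAt_bernoulliSum A x,
    Finset.sum_le_sum fun i _ => bernoulliSum_pivotalSet_le hA hx0 hx1 i⟩

end Russo

/-! ### Events determined by finitely many edges -/

section Cylinder

variable {d : ℕ}

instance (p : I) : IsProbabilityMeasure (bernoulliPerc d p) := by
  unfold bernoulliPerc; infer_instance

/-- The event `A` is determined by the states of the edges in `F`. -/
def DeterminedBy (F : Finset (Edge d)) (A : Set (Config d)) : Prop :=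
  ∀ ω ω' : Config d, (∀ e ∈ F, ω e = ω' e) → ω ∈ A → ω' ∈ A

open Classical in
/-- A finite configuration, with all other edges closed. -/
noncomputable def extendClosed (F : Finset (Edge d)) (T : F → Bool) : Config d :=
  fun e => if h : e ∈ F then T ⟨e, h⟩ else false

theorem DeterminedBy.mono {F G : Finset (Edge d)} {A : Set (Config d)} (h : DeterminedBy F A)
    (hFG : F ⊆ G) : DeterminedBy G A :=
  fun ω ω' hω => h ω ω' fun e he => hω e (hFG he)

theorem DeterminedBy.inter {F : Finset (Edge d)} {A B : Set (Config d)} (hA : DeterminedBy F A)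
    (hB : DeterminedBy F B) : DeterminedBy F (A ∩ B) :=
  fun ω ω' h hω => ⟨hA ω ω' h hω.1, hB ω ω' h hω.2⟩

theorem DeterminedBy.compl {F : Finset (Edge d)} {A : Set (Config d)} (hA : DeterminedBy F A) :
    DeterminedBy F Aᶜ :=
  fun ω ω' h hω hω' => hω (hA ω' ω (fun e he => (h e he).symm) hω')

theorem determinedBy_coord (e : Edge d) (b : Bool) : DeterminedBy {e} {ω : Config d | ω e = b} :=
  fun ω ω' h hω => by
    have := h e (Finset.mem_singleton_self e)
    simp only [Set.mem_ofPred_eq] at hω ⊢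
    rw [← this, hω]

/-- Exhibits the event as a cylinder; measurability, independence and the polynomial formula for its
probability all come from this. -/
theorem DeterminedBy.preimage_restrict {F : Finset (Edge d)} {A : Set (Config d)}
    (h : DeterminedBy F A) : F.restrict ⁻¹' (extendClosed F ⁻¹' A) = A := by
  ext ω
  have : ∀ e ∈ F, extendClosed F (F.restrict ω) e = ω e := fun e he => by
    simp [extendClosed, he]
  exact ⟨h _ _ this, h _ _ fun e he => (this e he).symm⟩

theorem DeterminedBy.measurableSet {F : Finset (Edge d)} {A : Set (Config d)}
    (h : DeterminedBy F A) : MeasurableSet A := by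
  rw [← h.preimage_restrict]
  exact (Finset.measurable_restrict F) (Set.toFinite _).measurableSet

theorem DeterminedBy.measure_inter {F G : Finset (Edge d)} (hFG : Disjoint F G)
    {A B : Set (Config d)} (hA : DeterminedBy F A) (hB : DeterminedBy G B) (p : I) :
    (bernoulliPerc d p).real (A ∩ B)
      = (bernoulliPerc d p).real A * (bernoulliPerc d p).real B := by
  have hind : iIndepFun (fun (e : Edge d) (ω : Config d) => ω e) (bernoulliPerc d p) :=
    iIndepFun_infinitePi (P := fun _ : Edge d => bernoulliMeasure true false p)
      (X := fun _ ω => ω) fun _ => measurable_id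
  have h := (hind.indepFun_finset F G hFG fun e => measurable_pi_apply e).measure_inter_preimage_eq_mul
    (extendClosed F ⁻¹' A) (extendClosed G ⁻¹' B) (Set.toFinite _).measurableSet
    (Set.toFinite _).measurableSet
  have hA' := hA.preimage_restrict
  have hB' := hB.preimage_restrict
  change bernoulliPerc d p (F.restrict ⁻¹' _ ∩ G.restrict ⁻¹' _)
    = bernoulliPerc d p (F.restrict ⁻¹' _) * bernoulliPerc d p (G.restrict ⁻¹' _) at h
  rw [hA', hB'] at h
  simp [measureReal_def, h]

theorem measureReal_coord_true (p : I) (e : Edge d) :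
    (bernoulliPerc d p).real {ω | ω e = true} = p := by
  have h : bernoulliPerc d p ((fun ω : Config d => ω e) ⁻¹' {true})
      = bernoulliMeasure true false p {true} := by
    rw [← Measure.infinitePi_map_eval (fun _ : Edge d => bernoulliMeasure true false p) e,
      Measure.map_apply (measurable_pi_apply e) (measurableSet_singleton _)]
    rfl
  change ((bernoulliPerc d p) ((fun ω : Config d => ω e) ⁻¹' {true})).toReal = p
  rw [h]
  exact bernoulliMeasure_real_apply_of_mem_of_notMem p (measurableSet_singleton _) rfl (by simp)

theorem DeterminedBy.measureReal_eq {F : Finset (Edge d)} {A : Set (Config d)}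
    (h : DeterminedBy F A) (p : I) :
    (bernoulliPerc d p).real A = bernoulliSum (extendClosed F ⁻¹' A) p := by
  classical
  have h1 : bernoulliPerc d p A = Measure.pi (fun _ : F => bernoulliMeasure true false p)
      (extendClosed F ⁻¹' A) := by
    conv_lhs => rw [← h.preimage_restrict]
    exact Measure.infinitePi_cylinder (fun _ : Edge d => bernoulliMeasure true false p)
      (Set.toFinite _).measurableSet
  have h2 : extendClosed F ⁻¹' A
      = ((Finset.univ.filter fun T => T ∈ extendClosed F ⁻¹' A : Finset (F → Bool)) :
        Set (F → Bool)) := by ext; simp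
  rw [measureReal_def, h1, ← measureReal_def, bernoulliSum, ← Finset.sum_filter]
  conv_lhs => rw [h2]
  rw [← sum_measureReal_singleton]
  refine Finset.sum_congr rfl fun T _ => ?_
  rw [measureReal_def, Measure.pi_singleton, ENNReal.toReal_prod, bernoulliWeight]
  refine Finset.prod_congr rfl fun e _ => ?_
  rw [← measureReal_def]
  cases T e
  · simp
  · simp

open Classical in
/-- The configurations outside `A` that enter `A` once the edge `e` is opened. -/
def pivotal (A : Set (Config d)) (e : Edge d) : Set (Config d) :=
  {ω | ω ∉ A ∧ Function.update ω e true ∈ A}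

theorem DeterminedBy.pivotal {F : Finset (Edge d)} {A : Set (Config d)} (h : DeterminedBy F A)
    (e : Edge d) : DeterminedBy F (pivotal A e) := by
  refine fun ω ω' hω hA => ⟨h.compl ω ω' hω hA.1, h _ _ (fun e' he' => ?_) hA.2⟩
  by_cases hee : e' = e
  · subst hee; simp
  · simp [Function.update_of_ne hee, hω e' he']

/-- Russo's inequality: an increasing event determined by finitely many edges has as probability
a function of `p` whose derivative is at least the sum of the pivotal probabilities. -/
theorem DeterminedBy.exists_hasDerivAt {F : Finset (Edge d)} {A : Set (Config d)}
    (h : DeterminedBy F A) (hA : IsUpperSet A) (p : I) :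
    ∃ D, HasDerivAt (bernoulliSum (extendClosed F ⁻¹' A)) D p ∧
      ∑ e ∈ F, (bernoulliPerc d p).real (Percolation.pivotal A e) ≤ D := by
  classical
  have hup : IsUpperSet (extendClosed F ⁻¹' A) := by
    refine fun T T' hT hTA => hA (fun e => ?_) hTA
    unfold extendClosed
    split_ifs
    · exact hT _
    · exact le_rfl
  obtain ⟨D, hD, hle⟩ := exists_hasDerivAt_bernoulliSum hup p.2.1 p.2.2
  refine ⟨D, hD, le_trans (le_of_eq ?_) hle⟩
  rw [← Finset.sum_coe_sort]
  refine Finset.sum_congr rfl fun e _ => ?_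
  rw [(h.pivotal e).measureReal_eq]
  congr 1
  ext T
  have : extendClosed F (Function.update T e true)
      = Function.update (extendClosed F T) e true := by
    funext e'
    by_cases hee : e' = e
    · subst hee; simp [extendClosed]
    · rw [Function.update_of_ne hee]
      unfold extendClosed
      split_ifs with he'
      · rw [Function.update_of_ne]
        intro h'; exact hee (congrArg Subtype.val h')
      · rfl
  simp only [Set.mem_preimage, Percolation.pivotal, pivotalSet, Set.mem_ofPred_eq, this]

theorem continuous_bernoulliSum {ι : Type*} [Fintype ι] [DecidableEq ι] (A : Set (ι → Bool)) :
    Continuous (bernoulliSum A) :=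
  continuous_iff_continuousAt.2 fun x => (hasDerivAt_bernoulliSum A x).continuousAt

theorem DeterminedBy.monotone_measureReal {F : Finset (Edge d)} {A : Set (Config d)}
    (h : DeterminedBy F A) (hA : IsUpperSet A) :
    Monotone fun p : I => (bernoulliPerc d p).real A := by
  classical
  have hm : MonotoneOn (bernoulliSum (extendClosed F ⁻¹' A)) (Set.Icc 0 1) := by
    refine monotoneOn_of_deriv_nonneg (convex_Icc 0 1) (continuous_bernoulliSum _).continuousOn
      (fun x _ => (hasDerivAt_bernoulliSum _ x).differentiableAt.differentiableWithinAt)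
      fun x hx => ?_
    obtain ⟨D, hD, hle⟩ := h.exists_hasDerivAt hA ⟨x, interior_subset hx⟩
    rw [hD.deriv]
    exact le_trans (Finset.sum_nonneg fun _ _ => measureReal_nonneg) hle
  intro p q hpq
  simp only [h.measureReal_eq]
  exact hm p.2 q.2 hpq

end Cylinder

/-! ### Open paths and exit events -/

section Connectivity

variable {d : ℕ}

/-- The edge between `a` and `b` exists and is open. -/
def OpenEdge (ω : Config d) (a b : Fin d → ℤ) : Prop :=
  ∃ h : s(a, b) ∈ (lattice d).edgeSet, ω ⟨s(a, b), h⟩ = true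

theorem openGraph_adj_iff (ω : Config d) (a b : Fin d → ℤ) :
    (openGraph ω).Adj a b ↔ OpenEdge ω a b := by
  simp only [openGraph, SimpleGraph.fromEdgeSet_adj, Set.mem_ofPred_eq, OpenEdge]
  exact ⟨fun h => h.1, fun h => ⟨h, SimpleGraph.Adj.ne (G := lattice d) h.1⟩⟩

theorem OpenEdge.symm {ω : Config d} {a b : Fin d → ℤ} (h : OpenEdge ω a b) : OpenEdge ω b a :=
  (openGraph_adj_iff ω b a).1 ((openGraph_adj_iff ω a b).2 h).symm

theorem OpenEdge.mono {ω ω' : Config d} {a b : Fin d → ℤ} (hω : ω ≤ ω') (h : OpenEdge ω a b) :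
    OpenEdge ω' a b :=
  ⟨h.1, Bool.eq_true_of_true_le (h.2 ▸ hω ⟨s(a, b), h.1⟩)⟩

/-- One step along an open edge with both endpoints in `D`. -/
def OpenStep (ω : Config d) (D : Set (Fin d → ℤ)) (a b : Fin d → ℤ) : Prop :=
  OpenEdge ω a b ∧ a ∈ D ∧ b ∈ D

/-- There is an open path from `a` to `b` along edges with both endpoints in `D`. -/
abbrev ConnIn (ω : Config d) (D : Set (Fin d → ℤ)) : (Fin d → ℤ) → (Fin d → ℤ) → Prop :=
  Relation.ReflTransGen (OpenStep ω D)

/-- There is an open path inside `D` from `x` to the complement of `B`. -/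
def Exits (D : Set (Fin d → ℤ)) (B : Finset (Fin d → ℤ)) (x : Fin d → ℤ) : Set (Config d) :=
  {ω | x ∈ D ∧ ∃ y ∉ B, ConnIn ω D x y}

theorem finite_edges_touching (B : Finset (Fin d → ℤ)) :
    {e : Edge d | ∃ x ∈ B, x ∈ e.1}.Finite := by
  have hfin : (⋃ x ∈ B, (fun y => s(x, y)) '' Set.Icc (x - 1) (x + 1)).Finite :=
    B.finite_toSet.biUnion fun x _ => (Set.finite_Icc _ _).image _
  refine Set.Finite.of_finite_image (f := Subtype.val) (hfin.subset ?_)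
    Subtype.val_injective.injOn
  rintro _ ⟨⟨e, he⟩, ⟨x, hxB, hxe⟩, rfl⟩
  obtain ⟨y, rfl⟩ := Sym2.mem_iff_exists.1 hxe
  simp only [Set.mem_iUnion]
  have hadj : ∑ i, (x i - y i) ^ 2 = 1 := he
  have hi : ∀ i, (x i - y i) ^ 2 ≤ 1 := fun i =>
    hadj ▸ Finset.single_le_sum (f := fun i => (x i - y i) ^ 2) (fun j _ => sq_nonneg _)
      (Finset.mem_univ i)
  refine ⟨x, hxB, y, ⟨fun i => ?_, fun i => ?_⟩, rfl⟩
  · have := hi i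
    simp only [Pi.sub_apply, Pi.one_apply]
    nlinarith
  · have := hi i
    simp only [Pi.add_apply, Pi.one_apply]
    nlinarith

/-- The edges with at least one endpoint in `B`. -/
noncomputable def touching (B : Finset (Fin d → ℤ)) : Finset (Edge d) :=
  (finite_edges_touching B).toFinset

theorem mem_touching {B : Finset (Fin d → ℤ)} {e : Edge d} :
    e ∈ touching B ↔ ∃ x ∈ B, x ∈ e.1 := by simp [touching]

open Classical in
/-- The edges with both endpoints in `S`. -/
noncomputable def inside (S : Finset (Fin d → ℤ)) : Finset (Edge d) :=
  (touching S).filter fun e => ∀ x ∈ e.1, x ∈ S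

theorem mem_inside {S : Finset (Fin d → ℤ)} {e : Edge d} :
    e ∈ inside S ↔ ∀ x ∈ e.1, x ∈ S := by
  classical
  rw [inside, Finset.mem_filter, mem_touching]
  refine ⟨fun h => h.2, fun h => ⟨?_, h⟩⟩
  obtain ⟨⟨a, b⟩, he⟩ := e
  exact ⟨a, h a (Sym2.mem_mk_left a b), Sym2.mem_mk_left a b⟩

theorem touching_mono {S B : Finset (Fin d → ℤ)} (h : S ⊆ B) : touching S ⊆ touching B := by
  intro e he
  obtain ⟨x, hx, hxe⟩ := mem_touching.1 he
  exact mem_touching.2 ⟨x, h hx, hxe⟩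

theorem isUpperSet_exits (D : Set (Fin d → ℤ)) (B : Finset (Fin d → ℤ)) (x : Fin d → ℤ) :
    IsUpperSet (Exits D B x) :=
  fun _ _ hω h => ⟨h.1, h.2.imp fun _ hy => ⟨hy.1, Relation.ReflTransGen.mono (fun _ _ hs => ⟨hs.1.mono hω, hs.2⟩) _ _ hy.2⟩⟩

theorem isUpperSet_connIn (D : Set (Fin d → ℤ)) (a b : Fin d → ℤ) :
    IsUpperSet {ω : Config d | ConnIn ω D a b} :=
  fun _ _ hω h => Relation.ReflTransGen.mono (fun _ _ hs => ⟨hs.1.mono hω, hs.2⟩) _ _ h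

theorem exits_of_step {ω : Config d} {D : Set (Fin d → ℤ)} {B : Finset (Fin d → ℤ)}
    {x y : Fin d → ℤ} (h : OpenStep ω D x y) (hy : ω ∈ Exits D B y) : ω ∈ Exits D B x :=
  ⟨h.2.1, hy.2.imp fun _ hz => ⟨hz.1, hz.2.head h⟩⟩

theorem exits_of_notMem {ω : Config d} {D : Set (Fin d → ℤ)} {B : Finset (Fin d → ℤ)}
    {x : Fin d → ℤ} (hD : x ∈ D) (hx : x ∉ B) : ω ∈ Exits D B x := ⟨hD, x, hx, .refl⟩

/-- Induction on an open path that leaves `B` within `D`. -/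
theorem exits_induction {ω : Config d} {D : Set (Fin d → ℤ)} {B : Finset (Fin d → ℤ)}
    {P : (Fin d → ℤ) → Prop} (h0 : ∀ x ∈ D, x ∉ B → P x)
    (h1 : ∀ x y, OpenStep ω D x y → ω ∈ Exits D B y → P y → P x)
    {x : Fin d → ℤ} (hx : ω ∈ Exits D B x) : P x := by
  obtain ⟨hxD, y, hy, hxy⟩ := hx
  induction hxy using Relation.ReflTransGen.head_induction_on with
  | refl => exact h0 y hxD hy
  | head hac hcb ih => exact h1 _ _ hac ⟨hac.2.2, y, hy, hcb⟩ (ih hac.2.2)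

open Classical in
-- Stop the path at its first vertex outside `B`: each edge used before starts in `B`, and none
-- touches `C`.
theorem determinedBy_exits_compl (B C : Finset (Fin d → ℤ)) (x : Fin d → ℤ) :
    DeterminedBy (touching B \ touching C) (Exits ((C : Set (Fin d → ℤ))ᶜ) B x) := by
  intro ω ω' hω hx
  refine exits_induction (P := fun x => ω' ∈ Exits ((C : Set (Fin d → ℤ))ᶜ) B x)
    (fun x hxD hxB => exits_of_notMem hxD hxB) (fun x y hs _ ih => ?_) hx
  by_cases hxB : x ∈ B
  · obtain ⟨⟨h, hopen⟩, hxD, hyD⟩ := hs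
    refine exits_of_step ⟨⟨h, ?_⟩, hxD, hyD⟩ ih
    rw [← hω ⟨s(x, y), h⟩, hopen]
    refine Finset.mem_sdiff.2 ⟨mem_touching.2 ⟨x, hxB, Sym2.mem_mk_left x y⟩, fun hC => ?_⟩
    obtain ⟨z, hzC, hz⟩ := mem_touching.1 hC
    rcases Sym2.mem_iff.1 hz with rfl | rfl
    · exact hxD hzC
    · exact hyD hzC
  · exact exits_of_notMem hs.2.1 hxB

theorem determinedBy_exits (B : Finset (Fin d → ℤ)) (x : Fin d → ℤ) :
    DeterminedBy (touching B) (Exits Set.univ B x) := by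
  classical
  simpa using (determinedBy_exits_compl B ∅ x).mono Finset.sdiff_subset

theorem determinedBy_connIn (S : Finset (Fin d → ℤ)) (a b : Fin d → ℤ) :
    DeterminedBy (inside S) {ω : Config d | ConnIn ω S a b} := by
  intro ω ω' hω h
  refine Relation.ReflTransGen.mono (fun x y hs => ?_) _ _ h
  refine ⟨⟨hs.1.1, ?_⟩, hs.2⟩
  rw [← hω _ (mem_inside.2 fun z hz => ?_), hs.1.2]
  rcases Sym2.mem_iff.1 hz with rfl | rfl
  · exact hs.2.1
  · exact hs.2.2

/-! ### The functional φ_p(S) -/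

/-- The edge `e` leaves `S` from a vertex connected to the origin inside `S`. -/
def boundaryEvent (S : Finset (Fin d → ℤ)) (e : Edge d) : Set (Config d) :=
  {ω | ∃ x ∈ S, ∃ y ∉ S, e.1 = s(x, y) ∧ ConnIn ω S 0 x}

theorem isUpperSet_boundaryEvent (S : Finset (Fin d → ℤ)) (e : Edge d) :
    IsUpperSet (boundaryEvent S e) :=
  fun _ _ hω ⟨x, hx, y, hy, he, hc⟩ => ⟨x, hx, y, hy, he, isUpperSet_connIn _ _ _ hω hc⟩

theorem determinedBy_boundaryEvent (S : Finset (Fin d → ℤ)) (e : Edge d) :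
    DeterminedBy (inside S) (boundaryEvent S e) :=
  fun _ _ hω ⟨x, hx, y, hy, he, hc⟩ => ⟨x, hx, y, hy, he, determinedBy_connIn S 0 x _ _ hω hc⟩

/-- The expected number of open edges that leave `S` from a vertex connected to the origin
inside `S`. -/
noncomputable def expectedBoundary (p : I) (S : Finset (Fin d → ℤ)) : ℝ :=
  p * ∑ e ∈ touching S, (bernoulliPerc d p).real (boundaryEvent S e)

theorem monotone_expectedBoundary (S : Finset (Fin d → ℤ)) :
    Monotone fun p : I => expectedBoundary p S := by
  intro p q hpq
  refine mul_le_mul hpq (Finset.sum_le_sum fun e _ => ?_)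
    (Finset.sum_nonneg fun _ _ => measureReal_nonneg) q.2.1
  exact (determinedBy_boundaryEvent S e).monotone_measureReal (isUpperSet_boundaryEvent S e) hpq

/-! ### Differential inequality: exploration from the outside -/

open Classical in
/-- The vertices of `B` that are not connected to the complement of `B`. -/
noncomputable def trapped (B : Finset (Fin d → ℤ)) (ω : Config d) : Finset (Fin d → ℤ) :=
  B.filter fun x => ω ∉ Exits Set.univ B x

theorem mem_trapped {B : Finset (Fin d → ℤ)} {ω : Config d} {x : Fin d → ℤ} :
    x ∈ trapped B ω ↔ ω ∉ Exits Set.univ B x := by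
  classical
  rw [trapped, Finset.mem_filter]
  exact ⟨fun h => h.2, fun h => ⟨by_contra fun hx => h (exits_of_notMem trivial hx), h⟩⟩

open Classical in
-- All vertices of an exiting path exit, hence avoid `S`, so exploring from outside never queries an
-- edge inside `S`. This makes the event independent of connections inside `S`.
theorem determinedBy_trapped (B S : Finset (Fin d → ℤ)) :
    DeterminedBy (touching B \ inside S) {ω | trapped B ω = S} := by
  intro ω ω' hω (hS : trapped B ω = S)
  have hmem : ∀ x, x ∈ S ↔ ω ∉ Exits Set.univ B x := fun x => by rw [← hS, mem_trapped]
  have h1 : ∀ x, ω ∈ Exits Set.univ B x → ω' ∈ Exits Set.univ B x := by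
    refine fun x hx => exits_induction (P := fun x => ω' ∈ Exits Set.univ B x)
      (fun x hxD hxB => exits_of_notMem hxD hxB) (fun x y hs hy ih => ?_) hx
    by_cases hxB : x ∈ B
    · obtain ⟨⟨h, hopen⟩, -⟩ := id hs
      refine exits_of_step ⟨⟨h, ?_⟩, trivial, trivial⟩ ih
      rw [← hω ⟨s(x, y), h⟩, hopen]
      refine Finset.mem_sdiff.2 ⟨mem_touching.2 ⟨x, hxB, Sym2.mem_mk_left x y⟩, fun hin => ?_⟩
      exact (hmem x).1 (mem_inside.1 hin x (Sym2.mem_mk_left x y)) (exits_of_step hs hy)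
    · exact exits_of_notMem trivial hxB
  -- Here the induction hypothesis puts `y` outside `S`: it already exits in `ω`, so the edge `xy`
  -- is not inside `S` and the configurations agree on it.
  have h2 : ∀ x, ω' ∈ Exits Set.univ B x → ω ∈ Exits Set.univ B x := by
    refine fun x hx => exits_induction (P := fun x => ω ∈ Exits Set.univ B x)
      (fun x hxD hxB => exits_of_notMem hxD hxB) (fun x y hs _ ih => ?_) hx
    by_contra hxS
    have hxB : x ∈ B := by_contra fun h => hxS (exits_of_notMem trivial h)
    obtain ⟨⟨h, hopen⟩, -⟩ := id hs
    refine hxS (exits_of_step ⟨⟨h, ?_⟩, trivial, trivial⟩ ih)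
    rw [hω ⟨s(x, y), h⟩, hopen]
    refine Finset.mem_sdiff.2 ⟨mem_touching.2 ⟨x, hxB, Sym2.mem_mk_left x y⟩, fun hin => ?_⟩
    exact (hmem y).1 (mem_inside.1 hin y (Sym2.mem_mk_right x y)) ih
  change trapped B ω' = S
  ext x
  rw [hmem, mem_trapped]
  exact not_congr ⟨h2 x, h1 x⟩

/-- The outer endpoint of `e` is not trapped, so it exits; opening `e` joins the origin to it
through the inner endpoint. -/
theorem pivotal_of_trapped {B S : Finset (Fin d → ℤ)} {e : Edge d} {ω : Config d} (h0 : 0 ∈ S)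
    (hS : trapped B ω = S) (he : ω ∈ boundaryEvent S e) :
    ω ∈ pivotal (Exits Set.univ B 0) e := by
  classical
  obtain ⟨x, -, y, hy, hexy, hc⟩ := he
  refine ⟨mem_trapped.1 (hS ▸ h0), ?_⟩
  have hle : ω ≤ Function.update ω e true := by
    rw [le_update_iff]; exact ⟨Bool.le_true _, fun _ _ => le_rfl⟩
  have hyE : ω ∈ Exits Set.univ B y := by
    by_contra h
    exact hy (hS ▸ mem_trapped.2 h)
  obtain ⟨e, hadj⟩ := e
  subst hexy
  have hx : Function.update ω ⟨s(x, y), hadj⟩ true ∈ Exits Set.univ B x :=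
    exits_of_step ⟨⟨hadj, Function.update_self ..⟩, trivial, trivial⟩
      (isUpperSet_exits _ _ _ hle hyE)
  have hc' : ConnIn (Function.update ω ⟨s(x, y), hadj⟩ true) Set.univ 0 x :=
    Relation.ReflTransGen.mono (fun _ _ hs => ⟨hs.1.mono hle, trivial, trivial⟩) _ _ hc
  obtain ⟨-, z, hz, hxz⟩ := hx
  convert! (⟨trivial, z, hz, hc'.trans hxz⟩ :
    Function.update ω ⟨s(x, y), hadj⟩ true ∈ Exits Set.univ B 0)

/-- If every finite set around the origin has expected boundary at least one, then the pivotal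
probabilities of the exit event sum to at least the probability of its complement. -/
theorem one_sub_le_sum_pivotal {p : I}
    (hp : ∀ S : Finset (Fin d → ℤ), 0 ∈ S → 1 ≤ expectedBoundary p S)
    (B : Finset (Fin d → ℤ)) :
    1 - (bernoulliPerc d p).real (Exits Set.univ B 0)
      ≤ ∑ e ∈ touching B, (bernoulliPerc d p).real (pivotal (Exits Set.univ B 0) e) := by
  classical
  set μ := bernoulliPerc d p
  set 𝒮 := B.powerset.filter fun S => (0 : Fin d → ℤ) ∈ S
  have hdisj : ∀ X : Finset (Fin d → ℤ) → Set (Config d),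
      (∀ S, X S ⊆ {ω | trapped B ω = S}) → Set.PairwiseDisjoint (𝒮 : Set _) X := by
    intro X hX S _ S' _ hne
    refine Set.disjoint_left.2 fun ω h h' => hne ?_
    exact (hX S h).symm.trans (hX S' h')
  have hpiv : ∀ e : Edge d, ∑ S ∈ 𝒮, μ.real {ω | trapped B ω = S} * μ.real (boundaryEvent S e)
      ≤ μ.real (pivotal (Exits Set.univ B 0) e) := by
    intro e
    have heq : ∀ S ∈ 𝒮, μ.real {ω | trapped B ω = S} * μ.real (boundaryEvent S e)
        = μ.real ({ω | trapped B ω = S} ∩ boundaryEvent S e) := fun S _ =>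
      (DeterminedBy.measure_inter Finset.sdiff_disjoint (determinedBy_trapped B S)
        (determinedBy_boundaryEvent S e) p).symm
    rw [Finset.sum_congr rfl heq, ← measureReal_biUnion_finset
      (hdisj _ fun S => Set.inter_subset_left)
      fun S _ => (determinedBy_trapped B S).measurableSet.inter
        (determinedBy_boundaryEvent S e).measurableSet]
    refine measureReal_mono (Set.iUnion₂_subset fun S hS ω hω => ?_)
    exact pivotal_of_trapped (Finset.mem_filter.1 hS).2 hω.1 hω.2
  -- The factor `p ≤ 1` in φ_p(S) is dropped: pivotality requires no open edge across the boundary.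
  have hone : ∀ S ∈ 𝒮, 1 ≤ ∑ e ∈ touching B, μ.real (boundaryEvent S e) := by
    intro S hS
    obtain ⟨hSB, h0⟩ := Finset.mem_filter.1 hS
    have hnn : 0 ≤ ∑ e ∈ touching S, μ.real (boundaryEvent S e) :=
      Finset.sum_nonneg fun _ _ => measureReal_nonneg
    calc 1 ≤ expectedBoundary p S := hp S h0
      _ ≤ ∑ e ∈ touching S, μ.real (boundaryEvent S e) := mul_le_of_le_one_left hnn p.2.2
      _ ≤ _ := Finset.sum_le_sum_of_subset_of_nonneg (touching_mono (Finset.mem_powerset.1 hSB))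
          fun _ _ _ => measureReal_nonneg
  -- The complement of the exit event is partitioned by the value of the trapped set, which then
  -- contains the origin.
  calc 1 - μ.real (Exits Set.univ B 0) = μ.real (Exits Set.univ B 0)ᶜ :=
        (probReal_compl_eq_one_sub (determinedBy_exits B 0).measurableSet).symm
    _ ≤ μ.real (⋃ S ∈ 𝒮, {ω | trapped B ω = S}) := by
        refine measureReal_mono (fun ω hω => Set.mem_iUnion₂.2 ⟨trapped B ω, ?_, rfl⟩)
          (measure_ne_top _ _)
        exact Finset.mem_filter.2 ⟨Finset.mem_powerset.2 (Finset.filter_subset _ _),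
          mem_trapped.2 hω⟩
    _ = ∑ S ∈ 𝒮, μ.real {ω | trapped B ω = S} :=
        measureReal_biUnion_finset (hdisj _ fun S => subset_rfl)
          fun S _ => (determinedBy_trapped B S).measurableSet
    _ ≤ ∑ S ∈ 𝒮, μ.real {ω | trapped B ω = S} * ∑ e ∈ touching B, μ.real (boundaryEvent S e) :=
        Finset.sum_le_sum fun S hS => le_mul_of_one_le_right measureReal_nonneg (hone S hS)
    _ = ∑ e ∈ touching B, ∑ S ∈ 𝒮,
          μ.real {ω | trapped B ω = S} * μ.real (boundaryEvent S e) := by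
        simp_rw [Finset.mul_sum]
        exact Finset.sum_comm
    _ ≤ _ := Finset.sum_le_sum fun e _ => hpiv e

/-! ### Renewal inequality: exploration from the origin -/

open Classical in
/-- The cluster of the origin inside `S`. -/
noncomputable def clusterIn (S : Finset (Fin d → ℤ)) (ω : Config d) : Finset (Fin d → ℤ) :=
  S.filter fun x => ConnIn ω S 0 x

theorem clusterIn_subset (S : Finset (Fin d → ℤ)) (ω : Config d) : clusterIn S ω ⊆ S := by
  classical
  exact Finset.filter_subset _ _

theorem mem_clusterIn {S : Finset (Fin d → ℤ)} {ω : Config d} {x : Fin d → ℤ} (h0 : 0 ∈ S) :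
    x ∈ clusterIn S ω ↔ ConnIn ω S 0 x := by
  classical
  rw [clusterIn, Finset.mem_filter]
  refine ⟨fun h => h.2, fun h => ⟨?_, h⟩⟩
  rcases Relation.ReflTransGen.cases_tail h with rfl | ⟨y, -, hy⟩
  · exact h0
  · exact hy.2.2

open Classical in
-- Exploring the cluster from the origin queries only edges inside `S` with an endpoint already
-- reached.
theorem determinedBy_clusterIn {S : Finset (Fin d → ℤ)} (h0 : 0 ∈ S) (C : Finset (Fin d → ℤ)) :
    DeterminedBy (inside S ∩ touching C) {ω | clusterIn S ω = C} := by
  intro ω ω' hω (hC : clusterIn S ω = C)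
  have hmem : ∀ x, x ∈ C ↔ ConnIn ω S 0 x := fun x => by rw [← hC, mem_clusterIn h0]
  have hedge : ∀ a b, ConnIn ω S 0 a → ∀ h : s(a, b) ∈ (lattice d).edgeSet, a ∈ S → b ∈ S →
      ω ⟨s(a, b), h⟩ = ω' ⟨s(a, b), h⟩ := fun a b hc h ha hb =>
    hω _ (Finset.mem_inter.2 ⟨mem_inside.2 fun z hz => by
      rcases Sym2.mem_iff.1 hz with rfl | rfl <;> assumption,
      mem_touching.2 ⟨a, (hmem a).2 hc, Sym2.mem_mk_left a b⟩⟩)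
  have h1 : ∀ x, ConnIn ω S 0 x → ConnIn ω' S 0 x := by
    intro x hx
    induction hx with
    | refl => exact .refl
    | tail hab hbc ih =>
      exact ih.tail ⟨⟨hbc.1.1, by rw [← hedge _ _ hab _ hbc.2.1 hbc.2.2, hbc.1.2]⟩, hbc.2⟩
  have h2 : ∀ x, ConnIn ω' S 0 x → ConnIn ω S 0 x := by
    intro x hx
    induction hx with
    | refl => exact .refl
    | tail hab hbc ih =>
      exact ih.tail ⟨⟨hbc.1.1, by rw [hedge _ _ ih _ hbc.2.1 hbc.2.2, hbc.1.2]⟩, hbc.2⟩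
  change clusterIn S ω' = C
  ext x
  rw [hmem, mem_clusterIn h0]
  exact ⟨h2 x, h1 x⟩

/-- A path from the cluster of the origin in `S` to the complement of `B ⊇ S` has a last edge
leaving the cluster, and that edge leaves `S`. -/
theorem exists_last_exit {S B : Finset (Fin d → ℤ)} (hSB : S ⊆ B) (h0 : 0 ∈ S) {ω : Config d}
    (hω : ω ∈ Exits Set.univ B 0) :
    ∃ x ∈ clusterIn S ω, ∃ y ∉ S, OpenEdge ω x y ∧
      ω ∈ Exits ((clusterIn S ω : Set (Fin d → ℤ))ᶜ) B y := by
  set C := clusterIn S ω with hC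
  have hCS : C ⊆ S := clusterIn_subset S ω
  have key : ω ∈ Exits ((C : Set (Fin d → ℤ))ᶜ) B 0 ∨ ∃ x ∈ C, ∃ y ∉ C, OpenEdge ω x y ∧
      ω ∈ Exits ((C : Set (Fin d → ℤ))ᶜ) B y := by
    -- Walk back from the end of the path: either the part seen so far avoids `C`, or the last edge
    -- out of `C` has been met.
    refine exits_induction (P := fun z => ω ∈ Exits ((C : Set (Fin d → ℤ))ᶜ) B z ∨
      ∃ x ∈ C, ∃ y ∉ C, OpenEdge ω x y ∧ ω ∈ Exits ((C : Set (Fin d → ℤ))ᶜ) B y)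
      (fun x _ hx => .inl (exits_of_notMem (fun h => hx (hSB (hCS h))) hx))
      (fun z w hs _ ih => ?_) hω
    rcases ih with ih | ih
    · by_cases hz : z ∈ C
      · exact .inr ⟨z, hz, w, ih.1, hs.1, ih⟩
      · exact .inl (exits_of_step ⟨hs.1, hz, ih.1⟩ ih)
    · exact .inr ih
  rcases key with h | ⟨x, hx, y, hy, hxy, hE⟩
  · exact absurd ((mem_clusterIn h0).2 .refl) h.1
  · refine ⟨x, hx, y, fun hyS => hy ?_, hxy, hE⟩
    exact (mem_clusterIn h0).2 (((mem_clusterIn h0).1 hx).tail ⟨hxy, hCS hx, hyS⟩)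

/-- Fix the cluster `C` of the origin in `S` and the last edge `xy` out of it. The cluster event,
the state of `xy` and the exit from `y` off `C` depend on disjoint sets of edges, so their
probabilities multiply. Summing over the `C` that contain an inner endpoint of the edge recovers
`boundaryEvent`. -/
theorem measureReal_exits_le {S B : Finset (Fin d → ℤ)} (hSB : S ⊆ B) (h0 : 0 ∈ S) (p : I) {u : ℝ}
    (hu : ∀ x ∈ S, ∀ y, (lattice d).Adj x y →
      (bernoulliPerc d p).real (Exits Set.univ B y) ≤ u) :
    (bernoulliPerc d p).real (Exits Set.univ B 0) ≤ expectedBoundary p S * u := by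
  classical
  set μ := bernoulliPerc d p
  let cross (C : Finset (Fin d → ℤ)) (e : Edge d) : Prop := ∃ x ∈ C, ∃ y ∉ S, e.1 = s(x, y)
  let W (C : Finset (Fin d → ℤ)) (e : Edge d) : Set (Config d) :=
    {ω | clusterIn S ω = C} ∩ ({ω | ω e = true} ∩
      {ω | ∃ y ∉ S, y ∈ e.1 ∧ ω ∈ Exits ((C : Set (Fin d → ℤ))ᶜ) B y})
  have hW : ∀ C ∈ S.powerset, ∀ e, cross C e →
      μ.real (W C e) ≤ μ.real {ω | clusterIn S ω = C} * (p * u) := by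
    rintro C hC ⟨e, he⟩ ⟨x, hx, y, hy, rfl⟩
    have hCS := Finset.mem_powerset.1 hC
    have hsub : W C ⟨s(x, y), he⟩ ⊆ {ω | clusterIn S ω = C} ∩ ({ω | ω ⟨s(x, y), he⟩ = true} ∩
        Exits ((C : Set (Fin d → ℤ))ᶜ) B y) := by
      refine Set.inter_subset_inter_right _ (Set.inter_subset_inter_right _ ?_)
      rintro ω ⟨z, hz, hze, hE⟩
      rcases Sym2.mem_iff.1 hze with rfl | rfl
      · exact absurd (hCS hx) hz
      · exact hE
    have heC : (⟨s(x, y), he⟩ : Edge d) ∈ touching C :=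
      mem_touching.2 ⟨x, hx, Sym2.mem_mk_left x y⟩
    have hd1 : Disjoint ({⟨s(x, y), he⟩} : Finset (Edge d)) (touching B \ touching C) :=
      Finset.disjoint_singleton_left.2 fun h => (Finset.mem_sdiff.1 h).2 heC
    have hd2 : Disjoint (inside S ∩ touching C)
        ({⟨s(x, y), he⟩} ∪ (touching B \ touching C)) := by
      refine Finset.disjoint_union_right.2 ⟨Finset.disjoint_singleton_right.2 fun h => ?_, ?_⟩
      · exact hy (mem_inside.1 (Finset.mem_inter.1 h).1 y (Sym2.mem_mk_right x y))
      · exact Finset.disjoint_left.2 fun e h h' =>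
          (Finset.mem_sdiff.1 h').2 (Finset.mem_inter.1 h).2
    have hD1 := determinedBy_coord (⟨s(x, y), he⟩ : Edge d) true
    have hD2 := determinedBy_exits_compl B C y
    calc μ.real (W C ⟨s(x, y), he⟩) ≤ _ := measureReal_mono hsub
      _ = μ.real {ω | clusterIn S ω = C} * (p * μ.real (Exits ((C : Set (Fin d → ℤ))ᶜ) B y)) := by
        rw [DeterminedBy.measure_inter hd2 (determinedBy_clusterIn h0 C)
          ((hD1.mono Finset.subset_union_left).inter (hD2.mono Finset.subset_union_right)),
          DeterminedBy.measure_inter hd1 hD1 hD2, measureReal_coord_true]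
      _ ≤ _ := by
        refine mul_le_mul_of_nonneg_left (mul_le_mul_of_nonneg_left ?_ p.2.1) measureReal_nonneg
        refine le_trans (measureReal_mono fun ω hω => ?_) (hu x (hCS hx) y he)
        exact ⟨trivial, hω.2.imp fun z hz =>
          ⟨hz.1, Relation.ReflTransGen.mono (fun _ _ hs => ⟨hs.1, trivial, trivial⟩) _ _ hz.2⟩⟩
  have hsum : ∀ e : Edge d, ∑ C ∈ S.powerset with cross C e, μ.real {ω | clusterIn S ω = C}
      ≤ μ.real (boundaryEvent S e) := by
    intro e
    rw [← measureReal_biUnion_finset]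
    · refine measureReal_mono (Set.iUnion₂_subset fun C hC ω (hω : clusterIn S ω = C) => ?_)
      obtain ⟨hCS, x, hx, y, hy, he⟩ := Finset.mem_filter.1 hC
      exact ⟨x, Finset.mem_powerset.1 hCS hx, y, hy, he, (mem_clusterIn h0).1 (hω ▸ hx)⟩
    · intro C _ C' _ hne
      exact Set.disjoint_left.2 fun ω h h' => hne (Eq.trans (Eq.symm h) h')
    · exact fun C _ => (determinedBy_clusterIn h0 C).measurableSet
  -- The sign of `u` is not assumed: either `u` bounds some probability or the sum over edges is
  -- empty.
  have hu0 : touching S = ∅ ∨ 0 ≤ u := by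
    rcases (touching S).eq_empty_or_nonempty with h | ⟨⟨e, he⟩, hm⟩
    · exact .inl h
    · obtain ⟨x, hx, hxe⟩ := mem_touching.1 hm
      obtain ⟨y, rfl⟩ := Sym2.mem_iff_exists.1 hxe
      exact .inr (measureReal_nonneg.trans (hu x hx y he))
  calc μ.real (Exits Set.univ B 0)
      ≤ μ.real (⋃ e ∈ touching S, ⋃ C ∈ S.powerset.filter fun C => cross C e, W C e) := by
        refine measureReal_mono (fun ω hω => ?_) (measure_ne_top _ _)
        obtain ⟨x, hx, y, hy, ⟨he, hopen⟩, hE⟩ := exists_last_exit hSB h0 hω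
        have hCS := clusterIn_subset S ω
        refine Set.mem_iUnion₂.2 ⟨⟨s(x, y), he⟩,
          mem_touching.2 ⟨x, hCS hx, Sym2.mem_mk_left x y⟩,
          Set.mem_iUnion₂.2 ⟨clusterIn S ω, Finset.mem_filter.2
            ⟨Finset.mem_powerset.2 hCS, x, hx, y, hy, rfl⟩, rfl, hopen, y, hy,
            Sym2.mem_mk_right x y, hE⟩⟩
    _ ≤ ∑ e ∈ touching S, ∑ C ∈ S.powerset with cross C e, μ.real (W C e) :=
        (measureReal_biUnion_finset_le _ _).trans
          (Finset.sum_le_sum fun e _ => measureReal_biUnion_finset_le _ _)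
    _ ≤ ∑ e ∈ touching S, ∑ C ∈ S.powerset with cross C e,
          μ.real {ω | clusterIn S ω = C} * (p * u) :=
        Finset.sum_le_sum fun e _ => Finset.sum_le_sum fun C hC =>
          hW C (Finset.mem_filter.1 hC).1 e (Finset.mem_filter.1 hC).2
    _ ≤ ∑ e ∈ touching S, μ.real (boundaryEvent S e) * (p * u) := by
        rcases hu0 with h | h
        · simp [h]
        · refine Finset.sum_le_sum fun e _ => ?_
          rw [← Finset.sum_mul]
          exact mul_le_mul_of_nonneg_right (hsum e) (mul_nonneg p.2.1 h)
    _ = expectedBoundary p S * u := by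
        rw [← Finset.sum_mul, expectedBoundary]
        ring

end Connectivity

/-! ### Translation invariance -/

section Translation

variable {d : ℕ}

/-- Translation by `v` acting on the edges. -/
noncomputable def shiftEdge (v : Fin d → ℤ) : Edge d ≃ Edge d :=
  SimpleGraph.Iso.mapEdgeSet (G := lattice d) (G' := lattice d)
    ⟨Equiv.addRight v, by intro a b; simp [lattice]⟩

theorem shiftEdge_apply (v a b : Fin d → ℤ) (h : s(a, b) ∈ (lattice d).edgeSet) :
    (shiftEdge v ⟨s(a, b), h⟩ : Sym2 (Fin d → ℤ)) = s(a + v, b + v) := rfl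

theorem measurePreserving_comp_shiftEdge (v : Fin d → ℤ) (p : I) :
    MeasurePreserving (fun ω : Config d => ω ∘ shiftEdge v) (bernoulliPerc d p)
      (bernoulliPerc d p) := by
  refine ⟨measurable_pi_lambda _ fun e => measurable_pi_apply _, ?_⟩
  convert! Measure.infinitePi_map_piCongrLeft
    (fun _ : Edge d => bernoulliMeasure true false p) (shiftEdge v).symm using 2
  funext ω e
  simp [MeasurableEquiv.piCongrLeft, Equiv.piCongrLeft, Equiv.piCongrLeft']

/-- A path from `v` out of `B` also leaves the translate `B' + v`, which lies in `B`; shift it back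
by `v`. -/
theorem measureReal_exits_translate_le {B B' : Finset (Fin d → ℤ)} {v : Fin d → ℤ}
    (hB : ∀ z ∈ B', z + v ∈ B) (p : I) :
    (bernoulliPerc d p).real (Exits Set.univ B v)
      ≤ (bernoulliPerc d p).real (Exits Set.univ B' 0) := by
  have hm := (measurePreserving_comp_shiftEdge v p).measureReal_preimage
    (determinedBy_exits B' (0 : Fin d → ℤ)).measurableSet.nullMeasurableSet
  rw [← hm]
  refine measureReal_mono ?_
  rintro ω ⟨-, y, hy, hvy⟩
  refine ⟨trivial, y - v, fun h => hy (by simpa using hB _ h), ?_⟩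
  have hlift : ConnIn (ω ∘ shiftEdge v) Set.univ (v - v) (y - v) := by
    refine Relation.ReflTransGen.lift (fun z => z - v) (fun a b hs => ?_) _ _ hvy
    obtain ⟨⟨h, hopen⟩, -⟩ := hs
    have h' : s(a - v, b - v) ∈ (lattice d).edgeSet := by
      rw [SimpleGraph.mem_edgeSet] at h ⊢
      simpa [lattice] using h
    refine ⟨⟨h', ?_⟩, trivial, trivial⟩
    rw [← hopen, Function.comp_apply]
    congr 1
    exact Subtype.ext (by rw [shiftEdge_apply]; simp)
  simpa using hlift

end Translation

/-! ### Cubes and infinite clusters -/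

section Cubes

variable {d : ℕ}

/-- The box `[-n, n]^d` as a finite set. -/
noncomputable def cube (d n : ℕ) : Finset (Fin d → ℤ) :=
  Finset.Icc (fun _ => -(n : ℤ)) fun _ => (n : ℤ)

theorem mem_cube {n : ℕ} {x : Fin d → ℤ} : x ∈ cube d n ↔ ∀ i, -(n : ℤ) ≤ x i ∧ x i ≤ n := by
  rw [cube, Finset.mem_Icc, Pi.le_def, Pi.le_def, ← forall_and]

theorem zero_mem_cube (n : ℕ) : (0 : Fin d → ℤ) ∈ cube d n := mem_cube.2 fun i => by simp

theorem cube_mono {m n : ℕ} (h : m ≤ n) : cube d m ⊆ cube d n := fun x hx =>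
  mem_cube.2 fun i => by
    have := mem_cube.1 hx i
    omega

theorem add_mem_cube {m n : ℕ} {x y : Fin d → ℤ} (hx : x ∈ cube d m) (hy : y ∈ cube d n) :
    x + y ∈ cube d (m + n) :=
  mem_cube.2 fun i => by
    have h1 := mem_cube.1 hx i
    have h2 := mem_cube.1 hy i
    simp only [Pi.add_apply]
    push_cast
    omega

theorem mem_cube_succ_of_adj {n : ℕ} {x y : Fin d → ℤ} (hx : x ∈ cube d n)
    (h : (lattice d).Adj x y) : y ∈ cube d (n + 1) := by
  have hadj : ∑ i, (x i - y i) ^ 2 = 1 := h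
  refine mem_cube.2 fun i => ?_
  have hi : (x i - y i) ^ 2 ≤ 1 :=
    hadj ▸ Finset.single_le_sum (f := fun i => (x i - y i) ^ 2) (fun j _ => sq_nonneg _)
      (Finset.mem_univ i)
  have hx := mem_cube.1 hx i
  push_cast
  constructor <;> nlinarith

theorem exists_subset_cube {s : Set (Fin d → ℤ)} (hs : s.Finite) : ∃ n, s ⊆ cube d n := by
  induction s, hs using Set.Finite.induction_on with
  | empty => exact ⟨0, by simp⟩
  | @insert x s _ _ ih =>
    obtain ⟨n, hn⟩ := ih
    refine ⟨max n (∑ i, (x i).natAbs), Set.insert_subset (mem_cube.2 fun i => ?_)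
      (hn.trans (cube_mono (le_max_left _ _)))⟩
    have h1 : (x i).natAbs ≤ ∑ i, (x i).natAbs :=
      Finset.single_le_sum (f := fun i => (x i).natAbs) (fun _ _ => Nat.zero_le _)
        (Finset.mem_univ i)
    have h2 := le_max_right n (∑ i, (x i).natAbs)
    omega

theorem exits_anti {B B' : Finset (Fin d → ℤ)} (h : B ⊆ B') (x : Fin d → ℤ) :
    Exits Set.univ B' x ⊆ Exits Set.univ B x :=
  fun _ hω => ⟨trivial, hω.2.imp fun _ hy => ⟨fun hB => hy.1 (h hB), hy.2⟩⟩

theorem reachable_iff_connIn (ω : Config d) (x y : Fin d → ℤ) :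
    (openGraph ω).Reachable x y ↔ ConnIn ω Set.univ x y := by
  rw [SimpleGraph.reachable_iff_reflTransGen, ConnIn]
  have : (openGraph ω).Adj = OpenStep ω Set.univ := by
    funext a b
    simp [openGraph_adj_iff, OpenStep]
  rw [this]

theorem connBoundary_subset_exits (n : ℕ) :
    connBoundary d ((n : ℤ) + 1) ⊆ Exits Set.univ (cube d n) 0 := by
  rintro ω ⟨y, ⟨-, hy⟩, hr⟩
  refine ⟨trivial, y, fun h => hy ?_, (reachable_iff_connIn ω 0 y).1 hr⟩
  have := mem_cube.1 h
  simpa [box] using this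

theorem mem_supp_iff_connIn (ω : Config d) (x y : Fin d → ℤ) :
    y ∈ ((openGraph ω).connectedComponentMk x).supp ↔ ConnIn ω Set.univ x y := by
  rw [SimpleGraph.ConnectedComponent.mem_supp_iff, SimpleGraph.ConnectedComponent.eq,
    ← reachable_iff_connIn]
  exact ⟨SimpleGraph.Reachable.symm, SimpleGraph.Reachable.symm⟩

theorem infinite_supp_iff (ω : Config d) (x : Fin d → ℤ) :
    ((openGraph ω).connectedComponentMk x).supp.Infinite
      ↔ ∀ n, ω ∈ Exits Set.univ (cube d n) x := by
  constructor
  · intro h n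
    obtain ⟨y, hy, hyn⟩ := h.exists_notMem_finset (cube d n)
    exact ⟨trivial, y, hyn, (mem_supp_iff_connIn ω x y).1 hy⟩
  · intro h hfin
    obtain ⟨n, hn⟩ := exists_subset_cube hfin
    obtain ⟨-, y, hy, hxy⟩ := h n
    exact hy (hn ((mem_supp_iff_connIn ω x y).2 hxy))

theorem connInfinity_eq_iInter : connInfinity d = ⋂ n, Exits Set.univ (cube d n) 0 := by
  ext ω
  rw [Set.mem_iInter]
  exact infinite_supp_iff ω 0

theorem existsInfinite_subset :
    existsInfinite d ⊆ ⋃ x : Fin d → ℤ, ⋂ n, Exits Set.univ (cube d n) x := by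
  rintro ω ⟨C, hC⟩
  induction C using SimpleGraph.ConnectedComponent.ind with
  | _ x => exact Set.mem_iUnion.2 ⟨x, Set.mem_iInter.2 ((infinite_supp_iff ω x).1 hC)⟩

theorem connInfinity_subset_existsInfinite : connInfinity d ⊆ existsInfinite d :=
  fun _ h => ⟨_, h⟩

/-! ### Exit probabilities and exponential decay -/

/-- The probability that the origin is connected to the complement of `[-n, n]^d`. -/
noncomputable def exitProb (d : ℕ) (p : I) (n : ℕ) : ℝ :=
  (bernoulliPerc d p).real (Exits Set.univ (cube d n) 0)

theorem exitProb_nonneg (p : I) (n : ℕ) : 0 ≤ exitProb d p n := measureReal_nonneg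

theorem antitone_exitProb (p : I) : Antitone (exitProb d p) :=
  fun _ _ h => measureReal_mono (exits_anti (cube_mono h) 0)

theorem le_connInfinity {p : I} {c : ℝ} (h : ∀ n, c ≤ exitProb d p n) :
    c ≤ (bernoulliPerc d p).real (connInfinity d) := by
  have hlim : Filter.Tendsto (exitProb d p) Filter.atTop
      (nhds ((bernoulliPerc d p).real (connInfinity d))) := by
    rw [connInfinity_eq_iInter]
    refine (ENNReal.tendsto_toReal (measure_ne_top _ _)).comp (tendsto_measure_iInter_atTop
      (fun n => (determinedBy_exits _ _).measurableSet.nullMeasurableSet)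
      (fun m n hmn => exits_anti (cube_mono hmn) 0) ⟨0, measure_ne_top _ _⟩)
  exact ge_of_tendsto' hlim h

/-- There are countably many vertices, and by translation each lies in an infinite cluster with
probability zero. -/
theorem measure_existsInfinite_eq_zero {p : I}
    (h : Filter.Tendsto (exitProb d p) Filter.atTop (nhds 0)) :
    bernoulliPerc d p (existsInfinite d) = 0 := by
  refine measure_mono_null existsInfinite_subset (measure_iUnion_null fun x => ?_)
  rw [← measureReal_eq_zero_iff]
  refine le_antisymm (ge_of_tendsto' h fun n => ?_) measureReal_nonneg
  obtain ⟨m, hm⟩ := exists_subset_cube (Set.finite_singleton x)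
  calc (bernoulliPerc d p).real (⋂ n, Exits Set.univ (cube d n) x)
      ≤ (bernoulliPerc d p).real (Exits Set.univ (cube d (n + m)) x) :=
        measureReal_mono (Set.iInter_subset _ _)
    _ ≤ exitProb d p n := measureReal_exits_translate_le
        (fun z hz => add_mem_cube hz (hm rfl)) p

/-- Renewal inequality for the exit probabilities. -/
theorem exists_exitProb_add_le {S : Finset (Fin d → ℤ)} (h0 : 0 ∈ S) (p : I) :
    ∃ L : ℕ, 1 ≤ L ∧ ∀ n, exitProb d p (n + L) ≤ expectedBoundary p S * exitProb d p n := by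
  obtain ⟨m, hm⟩ := exists_subset_cube S.finite_toSet
  refine ⟨m + 1, by omega, fun n => measureReal_exits_le
    (fun x hx => cube_mono (by omega) (hm hx)) h0 p fun x hx y hxy => ?_⟩
  exact measureReal_exits_translate_le
    (fun z hz => add_mem_cube hz (mem_cube_succ_of_adj (hm hx) hxy)) p

/-- With positive probability all edges at the origin are closed. The strict bound starts the decay:
renewal alone says nothing about the first `L` terms. -/
theorem exitProb_zero_lt_one {p : I} (hp : (p : ℝ) < 1) : exitProb d p 0 < 1 := by
  have hmeas := (determinedBy_exits (cube d 0) (0 : Fin d → ℤ)).measurableSet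
  have hpos : 0 < (bernoulliPerc d p).real (Exits Set.univ (cube d 0) 0)ᶜ := by
    refine lt_of_lt_of_le ?_ (measureReal_mono
      (s₁ := Set.pi (touching (cube d 0) : Set (Edge d)) fun _ => {false}) fun ω hω hE => ?_)
    · rw [measureReal_def, bernoulliPerc, Measure.infinitePi_pi _
        fun _ _ => measurableSet_singleton _, ENNReal.toReal_prod]
      refine Finset.prod_pos fun e _ => ?_
      rw [← measureReal_def]
      simpa using hp
    · obtain ⟨-, y, hy, h⟩ := hE
      rcases Relation.ReflTransGen.cases_head h with rfl | ⟨z, ⟨⟨he, hopen⟩, -⟩, -⟩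
      · exact hy (zero_mem_cube 0)
      · have := hω ⟨s(0, z), he⟩ (mem_touching.2 ⟨0, zero_mem_cube 0, Sym2.mem_mk_left 0 z⟩)
        simp [hopen] at this
  rw [probReal_compl_eq_one_sub hmeas] at hpos
  unfold exitProb
  linarith

/-- A renewal inequality with factor less than one gives exponential decay. -/
theorem exists_exp_decay {v : ℕ → ℝ} (hnn : ∀ n, 0 ≤ v n) (hv : Antitone v) (h0 : v 0 < 1)
    {φ : ℝ} (hφ : φ < 1) {L : ℕ} (hL : 1 ≤ L) (hrec : ∀ n, v (n + L) ≤ φ * v n) :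
    ∃ c : ℝ, 0 < c ∧ ∀ n : ℕ, v n ≤ Real.exp (-c * (n + 1)) := by
  -- One ratio serves both the initial terms and the recursion; `1 / 2` keeps it positive for the
  -- logarithm. The rate `c` is then fixed by `exp (-c L) = r`.
  obtain ⟨r, hr, hr1⟩ : ∃ r, max (max (v 0) φ) (1 / 2) ≤ r ∧ r < 1 :=
    ⟨_, le_rfl, by simp [h0, hφ]; norm_num⟩
  have hr0 : 0 < r := lt_of_lt_of_le (by norm_num) (le_trans (le_max_right _ _) hr)
  have hrv : v 0 ≤ r := (le_max_left _ _).trans ((le_max_left _ _).trans hr)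
  have hrφ : φ ≤ r := (le_max_right _ _).trans ((le_max_left _ _).trans hr)
  have hLpos : (0 : ℝ) < L := by exact_mod_cast hL
  set c := -Real.log r / L with hc
  have hcL : c * L = -Real.log r := by rw [hc]; field_simp
  have hrexp : r = Real.exp (-(c * L)) := by rw [hcL, neg_neg, Real.exp_log hr0]
  have hcpos : 0 < c := div_pos (neg_pos.2 (Real.log_neg hr0 hr1)) hLpos
  refine ⟨c, hcpos, fun n => ?_⟩
  induction n using Nat.strong_induction_on with
  | _ n ih =>
    by_cases hn : n < L
    · refine (hv (Nat.zero_le n)).trans (hrv.trans ?_)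
      rw [hrexp, Real.exp_le_exp]
      have : (n : ℝ) + 1 ≤ L := by exact_mod_cast hn
      nlinarith
    · obtain ⟨m, rfl⟩ := Nat.exists_eq_add_of_le' (not_lt.1 hn)
      calc v (m + L) ≤ r * v m := (hrec m).trans (mul_le_mul_of_nonneg_right hrφ (hnn m))
        _ ≤ r * Real.exp (-c * (m + 1)) :=
            mul_le_mul_of_nonneg_left (ih m (by omega)) hr0.le
        _ = Real.exp (-c * (((m + L : ℕ) : ℝ) + 1)) := by
            rw [hrexp, ← Real.exp_add]
            push_cast
            ring_nf

theorem exitProb_exp_decay {p : I} (hp : (p : ℝ) < 1) {S : Finset (Fin d → ℤ)} (h0 : 0 ∈ S)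
    (hS : expectedBoundary p S < 1) :
    ∃ c : ℝ, 0 < c ∧ ∀ n : ℕ, exitProb d p n ≤ Real.exp (-c * (n + 1)) := by
  obtain ⟨L, hL, hrec⟩ := exists_exitProb_add_le h0 p
  exact exists_exp_decay (exitProb_nonneg p) (antitone_exitProb p) (exitProb_zero_lt_one hp) hS hL
    hrec

theorem measure_existsInfinite_eq_zero_of_expectedBoundary {p : I} (hp : (p : ℝ) < 1)
    {S : Finset (Fin d → ℤ)} (h0 : 0 ∈ S) (hS : expectedBoundary p S < 1) :
    bernoulliPerc d p (existsInfinite d) = 0 := by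
  obtain ⟨c, hc, hle⟩ := exitProb_exp_decay hp h0 hS
  refine measure_existsInfinite_eq_zero (squeeze_zero (exitProb_nonneg p) hle ?_)
  refine Real.tendsto_exp_atBot.comp (Filter.Tendsto.const_mul_atTop_of_neg (neg_lt_zero.2 hc) ?_)
  exact Filter.tendsto_atTop_add_const_right _ _ tendsto_natCast_atTop_atTop

/-! ### Integration and the critical point -/

/-- Integrated differential inequality: if between `a` and `p` all expected boundaries are at least
one, the origin is in an infinite cluster with probability at least `(p - a) / 2`. -/
theorem half_sub_le_connInfinity {a : ℝ} (ha : 0 ≤ a) {p : I} (hap : a ≤ p)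
    (h : ∀ q : I, a < q → (q : ℝ) < p → ∀ S : Finset (Fin d → ℤ), 0 ∈ S →
      1 ≤ expectedBoundary q S) :
    1 / 2 * ((p : ℝ) - a) ≤ (bernoulliPerc d p).real (connInfinity d) := by
  classical
  refine le_connInfinity fun n => ?_
  have hdet := determinedBy_exits (cube d n) (0 : Fin d → ℤ)
  have hup := isUpperSet_exits (d := d) Set.univ (cube d n) 0
  set f := bernoulliSum (extendClosed (touching (cube d n)) ⁻¹' Exits Set.univ (cube d n) 0)
  have hfp : ∀ q : I, (bernoulliPerc d q).real (Exits Set.univ (cube d n) 0) = f q :=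
    fun q => hdet.measureReal_eq q
  have hdiff : Differentiable ℝ f := fun x => (hasDerivAt_bernoulliSum _ x).differentiableAt
  -- `Real.exp` is the integrating factor of `f' ≥ 1 - f`.
  have hanti : AntitoneOn (fun x => (1 - f x) * Real.exp x) (Set.Icc a p) := by
    refine antitoneOn_of_deriv_nonpos (convex_Icc _ _)
      (Continuous.continuousOn ((continuous_const.sub hdiff.continuous).mul Real.continuous_exp))
      (Differentiable.differentiableOn (((differentiable_const 1).sub hdiff).mul
        Real.differentiable_exp)) fun x hx => ?_
    rw [interior_Icc] at hx
    set q : I := ⟨x, ha.trans hx.1.le, hx.2.le.trans p.2.2⟩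
    obtain ⟨D, hD, hle⟩ := hdet.exists_hasDerivAt hup q
    have h1 := (one_sub_le_sum_pivotal (h q hx.1 hx.2) (cube d n)).trans hle
    rw [hfp q] at h1
    have h2 : HasDerivAt (fun x => (1 - f x) * Real.exp x)
        ((-D) * Real.exp x + (1 - f x) * Real.exp x) x :=
      (hD.const_sub 1).mul (Real.hasDerivAt_exp x)
    rw [h2.deriv, ← add_mul]
    exact mul_nonpos_of_nonpos_of_nonneg (by change 1 - f x ≤ D at h1; linarith)
      (Real.exp_pos x).le
  have hcmp := hanti (Set.left_mem_Icc.2 hap) (Set.right_mem_Icc.2 hap) hap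
  simp only at hcmp
  have hfa : 0 ≤ f a := by
    have := hfp ⟨a, ha, hap.trans p.2.2⟩
    exact this ▸ measureReal_nonneg
  rw [exitProb, hfp p]
  set t := (p : ℝ) - a with ht
  have ht0 : 0 ≤ t := sub_nonneg.2 hap
  have ht1 : t ≤ 1 := by have := p.2.2; linarith
  have hexp : Real.exp p = Real.exp a * Real.exp t := by rw [← Real.exp_add, ht]; ring_nf
  have hmul : (1 - f p) * Real.exp t ≤ 1 := by
    have hpos := Real.exp_pos a
    rw [hexp] at hcmp
    have : Real.exp a * ((1 - f p) * Real.exp t) ≤ Real.exp a * 1 := by nlinarith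
    exact le_of_mul_le_mul_left this hpos
  have hle1 : f p ≤ 1 := by rw [← hfp p]; exact measureReal_le_one
  -- Hence `f p ≥ t / (1 + t)`, which is at least `t / 2` because `t ≤ 1`; this is the source of the
  -- constant `1 / 2`.
  have hlin : (1 - f p) * (t + 1) ≤ 1 :=
    (mul_le_mul_of_nonneg_left (Real.add_one_le_exp t) (by linarith)).trans hmul
  nlinarith

theorem zero_mem_subcritical :
    (0 : ℝ) ∈ {p : ℝ | ∃ h : p ∈ I, bernoulliPerc d ⟨p, h⟩ (existsInfinite d) = 0} := by
  refine ⟨⟨le_rfl, zero_le_one⟩, ?_⟩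
  refine measure_existsInfinite_eq_zero_of_expectedBoundary (S := {0}) (by simp) (by simp) ?_
  simp [expectedBoundary]

theorem bddAbove_subcritical :
    BddAbove {p : ℝ | ∃ h : p ∈ I, bernoulliPerc d ⟨p, h⟩ (existsInfinite d) = 0} :=
  ⟨1, fun _ hp => hp.1.2⟩

theorem criticalPoint_nonneg : 0 ≤ criticalPoint d :=
  le_csSup bddAbove_subcritical zero_mem_subcritical

theorem criticalPoint_le_one : criticalPoint d ≤ 1 :=
  csSup_le ⟨0, zero_mem_subcritical⟩ fun _ hp => hp.1.2

/-- Otherwise φ ≥ 1 persists by monotonicity up to some `p' > p` without infinite clusters, where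
the integrated inequality forces a positive probability. -/
theorem exists_expectedBoundary_lt_one {p : I} (hp : (p : ℝ) < criticalPoint d) :
    ∃ S : Finset (Fin d → ℤ), 0 ∈ S ∧ expectedBoundary p S < 1 := by
  by_contra! hcon
  obtain ⟨p', ⟨hp'I, hp'⟩, hpp'⟩ := exists_lt_of_lt_csSup ⟨0, zero_mem_subcritical⟩ hp
  have hle := half_sub_le_connInfinity p.2.1 (p := ⟨p', hp'I⟩) hpp'.le
    fun q hpq _ S h0 => (hcon S h0).trans (monotone_expectedBoundary S hpq.le)
  have h0 : (bernoulliPerc d ⟨p', hp'I⟩).real (connInfinity d) = 0 := by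
    rw [measureReal_eq_zero_iff]
    exact measure_mono_null connInfinity_subset_existsInfinite hp'
  rw [h0] at hle
  linarith

end Cubes

end Percolation

theorem mainTheorem2 (d : ℕ) (hd : 1 ≤ d) :
    (∀ p : I, (p : ℝ) < Percolation.criticalPoint d →
      ∃ c : ℝ, 0 < c ∧ ∀ n : ℕ, 1 ≤ n →
        (Percolation.bernoulliPerc d p).real (Percolation.connBoundary d n)
          ≤ Real.exp (-c * n)) ∧
    (∃ c : ℝ, 0 < c ∧ ∀ p : I, Percolation.criticalPoint d < (p : ℝ) →
      c * ((p : ℝ) - Percolation.criticalPoint d)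
        ≤ (Percolation.bernoulliPerc d p).real (Percolation.connInfinity d)) := by
  refine ⟨fun p hp => ?_, 1 / 2, by norm_num, fun p hp => ?_⟩
  · obtain ⟨S, h0, hS⟩ := Percolation.exists_expectedBoundary_lt_one hp
    obtain ⟨c, hc, hdecay⟩ := Percolation.exitProb_exp_decay
      (hp.trans_le Percolation.criticalPoint_le_one) h0 hS
    refine ⟨c, hc, fun n hn => ?_⟩
    -- Reaching the boundary of the box of radius `m + 1` means leaving the cube of radius `m`,
    -- which matches the exponent `m + 1` in the decay.
    obtain ⟨m, rfl⟩ := Nat.exists_eq_add_of_le' hn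
    push_cast
    exact (measureReal_mono (Percolation.connBoundary_subset_exits m)).trans (hdecay m)
  · refine Percolation.half_sub_le_connInfinity Percolation.criticalPoint_nonneg hp.le
      fun q hq hqp S h0 => ?_
    -- A set with φ_q(S) < 1 would exclude infinite clusters at `q`, placing `q` at or below p_c.
    by_contra! hS
    exact absurd (le_csSup Percolation.bddAbove_subcritical
      ⟨q.2, Percolation.measure_existsInfinite_eq_zero_of_expectedBoundary
        (hqp.trans_le p.2.2) h0 hS⟩) (not_le.2 hq)
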